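/- \textbf{Theorem.} $\Gamma_0$ is the least worm-perfect set of ordinals. That is, the ordinal $\Gamma_0$, regarded as the set $\{\xi : \xi<\Gamma_0\}$, is worm-perfect, and $\Gamma_0\subseteq\Theta$ for every worm-perfect set of ordinals $\Theta$. Here $\Gamma_0$ is the Feferman--Schütte ordinal, i.e. the least ordinal $\alpha$ with $\varphi_\alpha(0)=\alpha$, where $\varphi_0(\beta)=\omega^\beta$ and, for $\alpha>0$, $\varphi_\alpha$ enumerates the common fixed points of all $\varphi_{\alpha'}$, $\alpha'<\alpha$. The other notions are as follows. The formulas of the reflection calculus $\mathsf{RC}$ are given by the grammar $\top \mid \phi\wedge\psi \mid \langle\lambda\rangle\phi$, with $\lambda$ any ordinal. $\mathsf{RC}$ derives sequents $\phi\Rightarrow\psi$ by the following axioms and rules: $\phi\Rightarrow\phi$; $\phi\Rightarrow\top$; $\phi\wedge\psi\Rightarrow\phi$; $\phi\wedge\psi\Rightarrow\psi$; $\langle\lambda\rangle\langle\lambda\rangle\phi\Rightarrow\langle\lambda\rangle\phi$; $\langle\lambda\rangle\phi\Rightarrow\langle\mu\rangle\phi$ for $\mu\le\lambda$; $\langle\lambda\rangle\phi\wedge\langle\mu\rangle\psi\Rightarrow\langle\lambda\rangle(\phi\wedge\langle\mu\rangle\psi)$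 for $\mu<\lambda$; from $\phi\Rightarrow\psi$ and $\psi\Rightarrow\theta$ infer $\phi\Rightarrow\theta$; from $\phi\Rightarrow\psi$ and $\phi\Rightarrow\theta$ infer $\phi\Rightarrow\psi\wedge\theta$; from $\phi\Rightarrow\psi$ infer $\langle\lambda\rangle\phi\Rightarrow\langle\lambda\rangle\psi$. A worm is a formula $\mathfrak w=\langle\lambda_1\rangle\cdots\langle\lambda_n\rangle\top$ with $n\ge 0$; the ordinals $\lambda_1,\dots,\lambda_n$ are its entries. For worms put $\mathfrak v\lhd\mathfrak w$ if $\mathsf{RC}\vdash\mathfrak w\Rightarrow\langle 0\rangle\mathfrak v$; this relation is well-founded, and \[ o(\mathfrak w)=\bigcup_{\mathfrak v\lhd\mathfrak w}\bigl(o(\mathfrak v)+1\bigr) \] is the order-type of $\mathfrak w$. A set of ordinals $\Theta$ is worm-perfect if \[ \Theta=\{\,o(\mathfrak w) : \mathfrak w \text{ is a worm all of whose entries belong to } \Theta\,\}. \] -/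

import Mathlib

universe u

open scoped Ordinal

/-- Formulas of the (variable-free) reflection calculus `RC` with one modality `⟨l⟩` for every
ordinal `l`. -/
inductive RCFormula : Type (u + 1)
  | top : RCFormula
  | conj : RCFormula → RCFormula → RCFormula
  | dia : Ordinal.{u} → RCFormula → RCFormula

namespace RCFormula

/-- `Derives φ ψ` is `RC ⊢ φ ⇒ ψ`: the sequent `φ ⇒ ψ` is derivable in the reflection calculus. -/
inductive Derives : RCFormula.{u} → RCFormula.{u} → Prop
  | refl (φ : RCFormula.{u}) : Derives φ φ
  | top (φ : RCFormula.{u}) : Derives φ top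
  | trans {φ ψ θ : RCFormula.{u}} : Derives φ ψ → Derives ψ θ → Derives φ θ
  | conj_left (φ ψ : RCFormula.{u}) : Derives (conj φ ψ) φ
  | conj_right (φ ψ : RCFormula.{u}) : Derives (conj φ ψ) ψ
  | conj_intro {φ ψ θ : RCFormula.{u}} : Derives φ ψ → Derives φ θ → Derives φ (conj ψ θ)
  | four (l : Ordinal.{u}) (φ : RCFormula.{u}) : Derives (dia l (dia l φ)) (dia l φ)
  | nec (l : Ordinal.{u}) {φ ψ : RCFormula.{u}} : Derives φ ψ → Derives (dia l φ) (dia l ψ)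
  | mono {l m : Ordinal.{u}} (φ : RCFormula.{u}) : m ≤ l → Derives (dia l φ) (dia m φ)
  | six {l m : Ordinal.{u}} (φ ψ : RCFormula.{u}) : m < l →
      Derives (conj (dia l φ) (dia m ψ)) (dia l (conj φ (dia m ψ)))

/-- The worm `l₁ l₂ … lₙ ⊤`, i.e. the formula `⟨l₁⟩⟨l₂⟩ … ⟨lₙ⟩⊤`, given by the list of its
entries. -/
def worm : List Ordinal.{u} → RCFormula.{u}
  | [] => top
  | l :: w => dia l (worm w)

end RCFormula

namespace Worm

/-- The consistency ordering of worms (given by their lists of entries): `v` is below `w` if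
`RC ⊢ w ⇒ ⟨0⟩v`. -/
def Below (v w : List Ordinal.{u}) : Prop :=
  RCFormula.Derives (RCFormula.worm w) (RCFormula.dia 0 (RCFormula.worm v))

open Classical in
/-- The order-type `o(w) = ⋃ {o(v) + 1 : v below w}` of a worm in the consistency ordering,
i.e. its rank. As the worms with entries in `Ordinal.{u}` form a type in the universe `u + 1`,
the value is an element of `Ordinal.{u + 1}`, which contains `Ordinal.{u}` by `Ordinal.lift`.
The value `0` off the well-founded part is a dummy value (the ordering is well-founded). -/
noncomputable def o (w : List Ordinal.{u}) : Ordinal.{u + 1} :=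
  if h : Acc Below w then h.rank else 0

/-- `Θ` is worm-perfect if `Θ = {o(w) : w is a worm all of whose entries are in Θ}`. (The left hand
side is `Θ` itself, seen as a set of ordinals of the next universe.) -/
def IsWormPerfect (Θ : Set Ordinal.{u}) : Prop :=
  Ordinal.lift.{u + 1, u} '' Θ = o '' {w : List Ordinal.{u} | ∀ l ∈ w, l ∈ Θ}

end Worm

/-!
An ordinal `x < Γ₀` turns out to be the order-type of a worm with entries below `x`, and a worm with
entries below `Γ₀` has an order-type below `Γ₀`. Together the two facts say that `Γ₀` is
worm-perfect, and by induction on `x < Γ₀` the first one puts `x` into each worm-perfect set.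

**Upper bounds.** `RC` is sound for a topological model on the ordinals in which `⟨l⟩φ` holds at the
limit points of the truth set of `φ` in the `l`-th Icard topology. These topologies are defined
together with their Cantor–Bendixson ranks `cbRank l`: the `l`-th topology is generated by initial
segments and by the conditions `d < cbRank x a` with `x < l`. The identity `cbRank (m + z) a =
cbRank z (cbRank m a)` (`cbRank_add`) implies that truth sets of formulas are basic open and that
the truth set of `⟨m⟩ψ` is open in the `l`-th topology for `m < l` (`exists_sat_dia_iff_above`);
this gives soundness (`sat_of_derives`). The least point at which a worm holds then bounds its
order-type, and in particular the ordering of worms is well-founded. As `veblen l n` has `cbRank (ω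
^ l)` at least `n` (`le_cbRank_veblen`) and `Γ₀` is closed under the Veblen functions, worms with
entries below `Γ₀` hold at points below `Γ₀`.

**Lower bounds.** Adding `ω ^ b` on the left to all entries preserves derivability, and for `c < b`
the shift by `ω ^ c` fixes worms already shifted by `ω ^ b`, as `ω ^ c + ω ^ b = ω ^ b`. Hence the
worms below a shifted worm `ω ^ b + w` are closed under the shifts by `ω ^ c`, and induction on `b`
shows that `ω ^ b + w` has order-type at least `veblen b x` if `w` has order-type at least `1 + x`
(`veblen_le_orderType_map_add`). Thus the worms with entries below `ω ^ a` have order-types cofinal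
in `veblen a 0`. For infinite `x < Γ₀` and `a = log ω x` this suffices to get beyond `x` with
entries below `ω ^ a ≤ x`. Finally, worms below `w` have no larger entries than `w`, so `x` itself
is attained.
-/

namespace Worm

open Ordinal

/-! ### Iterated Cantor–Bendixson ranks on the ordinals -/

/-- `cbRank m a` is the Cantor–Bendixson rank of the point `a` in the `m`-th Icard topology on the
ordinals. That topology is generated by the initial segments `[0, b]` and the sets
`{b | d < cbRank x b}` with `x < m`, so a basic neighbourhood of `a` is given by a finite set `F` of
pairs `(x, d)` with `x < m` and `d < cbRank x a`, and consists of the `b ≤ a` with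
`d < cbRank x b` for all these pairs. The rank of `a` is the least ordinal that exceeds the ranks of
all points `b < a` in some neighbourhood of `a`. -/
noncomputable def cbRank (m a : Ordinal.{u}) : Ordinal.{u} :=
  sInf {n | ∃ F : Finset (Ordinal.{u} × Ordinal.{u}),
    (∀ p ∈ F, ∃ _ : p.1 < m, p.2 < cbRank p.1 a) ∧
    ∀ b, ∀ _ : b < a, (∀ p ∈ F, ∃ _ : p.1 < m, p.2 < cbRank p.1 b) → cbRank m b < n}
termination_by (m, a)

/-- `Above F a` says that `a` lies in the basic open set given by the finite set `F` of conditions: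
`d < cbRank x a` for all pairs `(x, d)` in `F`. -/
def Above (F : Finset (Ordinal.{u} × Ordinal.{u})) (a : Ordinal.{u}) : Prop :=
  ∀ p ∈ F, p.2 < cbRank p.1 a

theorem above_union {F G : Finset (Ordinal.{u} × Ordinal.{u})} {a : Ordinal.{u}} :
    Above (F ∪ G) a ↔ Above F a ∧ Above G a := by
  simp only [Above, Finset.mem_union]
  exact ⟨fun h => ⟨fun p hp => h p (.inl hp), fun p hp => h p (.inr hp)⟩,
    fun h p hp => hp.elim (h.1 p) (h.2 p)⟩

theorem cbRank_eq (m a : Ordinal.{u}) :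
    cbRank m a = sInf {n | ∃ F : Finset (Ordinal.{u} × Ordinal.{u}), (∀ p ∈ F, p.1 < m) ∧
      Above F a ∧ ∀ b < a, Above F b → cbRank m b < n} := by
  rw [cbRank]
  congr 1
  ext n
  constructor
  · rintro ⟨F, h1, h2⟩
    exact ⟨F, fun p hp => (h1 p hp).1, fun p hp => (h1 p hp).2,
      fun b hb h => h2 b hb fun p hp => ⟨(h1 p hp).1, h p hp⟩⟩
  · rintro ⟨F, h1, h2, h3⟩
    exact ⟨F, fun p hp => ⟨h1 p hp, h2 p hp⟩,
      fun b hb h => h3 b hb fun p hp => (h p hp).2⟩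

theorem cbRank_le_self (m a : Ordinal.{u}) : cbRank m a ≤ a := by
  induction a using WellFoundedLT.induction with
  | ind a ih =>
    rw [cbRank_eq]
    exact csInf_le' ⟨∅, by simp, by simp [Above], fun b hb _ => (ih b hb).trans_lt hb⟩

/-- Near `a`, all points below `a` have smaller rank than `a`. -/
theorem exists_nhd_cbRank_lt (m a : Ordinal.{u}) :
    ∃ F : Finset (Ordinal.{u} × Ordinal.{u}), (∀ p ∈ F, p.1 < m) ∧
      Above F a ∧ ∀ b < a, Above F b → cbRank m b < cbRank m a := by
  have h := csInf_mem (s := {n | ∃ F : Finset (Ordinal.{u} × Ordinal.{u}), (∀ p ∈ F, p.1 < m) ∧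
      Above F a ∧ ∀ b < a, Above F b → cbRank m b < n})
    ⟨a, ∅, by simp, by simp [Above], fun b hb _ => (cbRank_le_self m b).trans_lt hb⟩
  rwa [← cbRank_eq] at h

/-- Every value below the rank of `a` is attained below `a` in each neighbourhood of `a`. -/
theorem exists_cbRank_eq {m a n : Ordinal.{u}} (hn : n < cbRank m a)
    {F : Finset (Ordinal.{u} × Ordinal.{u})} (hF : ∀ p ∈ F, p.1 < m) (hFa : Above F a) :
    ∃ b < a, Above F b ∧ cbRank m b = n := by
  induction a using WellFoundedLT.induction with
  | ind a ih =>
    have h : n ∉ {n | ∃ F : Finset (Ordinal.{u} × Ordinal.{u}), (∀ p ∈ F, p.1 < m) ∧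
        Above F a ∧ ∀ b < a, Above F b → cbRank m b < n} := by
      rw [cbRank_eq] at hn
      exact notMem_of_lt_csInf' hn
    simp only [Set.mem_ofPred_eq, not_exists, not_and, not_forall, not_lt] at h
    obtain ⟨b, hb, hFb, hnb⟩ := h F hF hFa
    rcases hnb.eq_or_lt with e | hlt
    · exact ⟨b, hb, hFb, e.symm⟩
    · obtain ⟨c, hc, h⟩ := ih b hb hlt hFb
      exact ⟨c, hc.trans hb, h⟩

theorem le_cbRank {m a x : Ordinal.{u}}
    (h : ∀ n < x, ∀ F : Finset (Ordinal.{u} × Ordinal.{u}), (∀ p ∈ F, p.1 < m) → Above F a →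
      ∃ b < a, Above F b ∧ n ≤ cbRank m b) : x ≤ cbRank m a := by
  by_contra! hx
  obtain ⟨F, hF, hFa, hlt⟩ := exists_nhd_cbRank_lt m a
  obtain ⟨b, hb, hFb, hle⟩ := h _ hx F hF hFa
  exact (hlt b hb hFb).not_ge hle

theorem cbRank_zero (a : Ordinal.{u}) : cbRank 0 a = a := by
  induction a using WellFoundedLT.induction with
  | ind a ih =>
    refine (cbRank_le_self 0 a).antisymm (le_cbRank fun n hn F hF _ => ⟨n, hn, ?_, (ih n hn).ge⟩)
    exact fun p hp => absurd (hF p hp) not_lt_zero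

/-- `cbRank m` is open and continuous from the `(m + z)`-th to the `z`-th topology and has discrete
fibres, so that it preserves ranks. -/
theorem cbRank_add (m z a : Ordinal.{u}) : cbRank (m + z) a = cbRank z (cbRank m a) := by
  classical
  induction z using WellFoundedLT.induction generalizing a with
  | ind z ihz =>
  induction a using WellFoundedLT.induction with
  | ind a iha =>
  apply le_antisymm
  · by_contra! hlt
    obtain ⟨F, hF, hFa, hF'⟩ := exists_nhd_cbRank_lt z (cbRank m a)
    obtain ⟨G, hG, hGa, hG'⟩ := exists_nhd_cbRank_lt m a
    obtain ⟨b, hb, hab, e⟩ := exists_cbRank_eq hlt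
      (F := G ∪ F.image fun p => (m + p.1, p.2)) (by
        intro p hp
        simp only [Finset.mem_union, Finset.mem_image] at hp
        rcases hp with hp | ⟨q, hq, rfl⟩
        · exact (hG p hp).trans_le le_self_add
        · simpa using hF q hq)
      (above_union.2 ⟨hGa, by
        intro p hp
        obtain ⟨q, hq, rfl⟩ := Finset.mem_image.1 hp
        simpa only [ihz _ (hF q hq)] using hFa q hq⟩)
    obtain ⟨hGb, hFb⟩ := above_union.1 hab
    refine (hF' (cbRank m b) (hG' b hb hGb) fun q hq => ?_).ne ((iha b hb).symm.trans e)
    simpa only [ihz _ (hF q hq)] using hFb _ (Finset.mem_image_of_mem _ hq)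
  · refine le_cbRank fun n hn F hF hFa => ?_
    -- The conditions at levels `x < m` are kept; those at levels `m + x` become conditions on the
    -- value of `cbRank m`.
    obtain ⟨c, hc, hGc, e⟩ := exists_cbRank_eq hn
      (F := (F.filter fun p => m ≤ p.1).image fun p => (p.1 - m, p.2)) (by
        intro p hp
        simp only [Finset.mem_image, Finset.mem_filter] at hp
        obtain ⟨q, ⟨hq, hmq⟩, rfl⟩ := hp
        exact (Ordinal.sub_lt_of_le hmq).2 (hF q hq))
      (by
        intro p hp
        simp only [Finset.mem_image, Finset.mem_filter] at hp
        obtain ⟨q, ⟨hq, hmq⟩, rfl⟩ := hp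
        have := hFa q hq
        rwa [← Ordinal.add_sub_cancel_of_le hmq, ihz _ ((Ordinal.sub_lt_of_le hmq).2 (hF q hq))]
          at this)
    obtain ⟨b, hb, hGb, rfl⟩ := exists_cbRank_eq hc (F := F.filter fun p => p.1 < m)
      (fun p hp => (Finset.mem_filter.1 hp).2) (fun p hp => hFa p (Finset.mem_filter.1 hp).1)
    refine ⟨b, hb, fun p hp => ?_, (iha b hb ▸ e).ge⟩
    rcases lt_or_ge p.1 m with h | h
    · exact hGb p (Finset.mem_filter.2 ⟨hp, h⟩)
    · rw [← Ordinal.add_sub_cancel_of_le h, ihz _ ((Ordinal.sub_lt_of_le h).2 (hF p hp))]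
      exact hGc _ (Finset.mem_image_of_mem _ (Finset.mem_filter.2 ⟨hp, h⟩))

theorem cbRank_antitone (a : Ordinal.{u}) : Antitone fun m => cbRank m a := by
  intro m l h
  simp only
  rw [← Ordinal.add_sub_cancel_of_le h, cbRank_add]
  exact cbRank_le_self _ _

/-- The order topology looks the same at `c + a` and at `a`, unless `a = 0`. -/
theorem cbRank_one_add_left (c : Ordinal.{u}) {a : Ordinal.{u}} (ha : 0 < a) :
    cbRank 1 (c + a) = cbRank 1 a := by
  classical
  induction a using WellFoundedLT.induction with
  | ind a ih =>
  apply le_antisymm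
  · by_contra! hlt
    obtain ⟨F, hF, hFa, hF'⟩ := exists_nhd_cbRank_lt 1 a
    have h0 : ∀ p ∈ F, p.1 = 0 := fun p hp => Order.lt_one_iff.1 (hF p hp)
    obtain ⟨b, hb, hab, e⟩ := exists_cbRank_eq hlt
      (F := {(0, c)} ∪ F.image fun p => (0, c + p.2))
      (by
        intro p hp
        simp only [Finset.mem_union, Finset.mem_image, Finset.mem_singleton] at hp
        rcases hp with rfl | ⟨q, hq, rfl⟩ <;> exact zero_lt_one)
      (above_union.2 ⟨by simpa [Above, cbRank_zero] using ha, by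
        intro p hp
        obtain ⟨q, hq, rfl⟩ := Finset.mem_image.1 hp
        simpa [cbRank_zero, h0 q hq] using hFa q hq⟩)
    obtain ⟨hcb, hFb⟩ := above_union.1 hab
    have hcb : c < b := by simpa [Above, cbRank_zero] using hcb
    obtain ⟨b, rfl⟩ := exists_add_of_le hcb.le
    have hb0 : 0 < b := by simpa using hcb
    have hba : b < a := by simpa using hb
    refine (hF' b hba fun q hq => ?_).ne ((ih b hba hb0).symm.trans e)
    have := hFb _ (Finset.mem_image_of_mem _ hq)
    simpa [cbRank_zero, h0 q hq] using this
  · refine le_cbRank fun n hn F hF hFa => ?_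
    have h0 : ∀ p ∈ F, p.1 = 0 := fun p hp => Order.lt_one_iff.1 (hF p hp)
    obtain ⟨b, hb, hab, e⟩ := exists_cbRank_eq hn
      (F := {(0, 0)} ∪ F.image fun p => (0, p.2 - c))
      (by
        intro p hp
        simp only [Finset.mem_union, Finset.mem_image, Finset.mem_singleton] at hp
        rcases hp with rfl | ⟨q, hq, rfl⟩ <;> exact zero_lt_one)
      (above_union.2 ⟨by simpa [Above, cbRank_zero] using ha, by
        intro p hp
        obtain ⟨q, hq, rfl⟩ := Finset.mem_image.1 hp
        have := hFa q hq
        simp only [h0 q hq, cbRank_zero] at this ⊢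
        exact Ordinal.sub_lt_of_lt_add this ha⟩)
    obtain ⟨hb0, hFb⟩ := above_union.1 hab
    have hb0 : 0 < b := by simpa [Above, cbRank_zero] using hb0
    refine ⟨c + b, by simpa using hb, fun p hp => ?_, ((ih b hb hb0).trans e).ge⟩
    have := hFb _ (Finset.mem_image_of_mem _ hp)
    simp only [cbRank_zero, h0 p hp] at this ⊢
    exact (Ordinal.le_add_sub p.2 c).trans_lt (by simpa using this)

theorem cbRank_add_left {m : Ordinal.{u}} (hm : 1 ≤ m) (c : Ordinal.{u}) {a : Ordinal.{u}}
    (ha : 0 < a) : cbRank m (c + a) = cbRank m a := by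
  rw [← Ordinal.add_sub_cancel_of_le hm, cbRank_add, cbRank_one_add_left c ha, ← cbRank_add]

/-- The Veblen function `veblen a` provides points of arbitrarily high rank at level `ω ^ a`:
`veblen a n` is a fixed point of the lower Veblen functions, hence by induction of all `cbRank x`
with `x < ω ^ a`. Below it, the points `d + veblen a n'` for `n' < n` come arbitrarily close. -/
theorem le_cbRank_veblen (a n : Ordinal.{u}) : n ≤ cbRank (ω ^ a) (veblen a n) := by
  induction a using WellFoundedLT.induction generalizing n with
  | ind a iha =>
  have fix : ∀ n, ∀ x < ω ^ a, cbRank x (veblen a n) = veblen a n := by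
    intro n x hx
    rcases eq_or_ne a 0 with rfl | ha
    · rw [opow_zero, Order.lt_one_iff] at hx
      rw [hx, cbRank_zero]
    · obtain ⟨b, hb, k, hk⟩ := (lt_omega0_opow ha).1 hx
      refine (cbRank_le_self _ _).antisymm (le_trans ?_ (cbRank_antitone _ hk.le))
      have hfix : cbRank (ω ^ b) (veblen a n) = veblen a n := by
        refine (cbRank_le_self _ _).antisymm ?_
        conv_rhs => rw [← veblen_veblen_of_lt hb]
        exact iha b hb _
      have : ∀ k : ℕ, cbRank (ω ^ b * k) (veblen a n) = veblen a n := by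
        intro k
        induction k with
        | zero => simp [cbRank_zero]
        | succ k ih => rw [Nat.cast_succ, mul_add_one, cbRank_add, ih, hfix]
      exact (this k).ge
  induction n using WellFoundedLT.induction with
  | ind n ihn =>
  refine le_cbRank fun n' hn' F hF hFa => ?_
  -- `x` and `d` bound the levels and the values in the conditions `F`.
  obtain ⟨x, hx, hFx⟩ : ∃ x < ω ^ a, ∀ p ∈ F, p.1 ≤ x :=
    ⟨F.sup Prod.fst, (Finset.sup_lt_iff (opow_pos a omega0_pos)).2 hF,
      fun p hp => Finset.le_sup (f := Prod.fst) hp⟩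
  obtain ⟨d, hd, hFd⟩ : ∃ d < veblen a n, ∀ p ∈ F, p.2 ≤ d :=
    ⟨F.sup Prod.snd, (Finset.sup_lt_iff veblen_pos).2
      fun p hp => (hFa p hp).trans_le (cbRank_le_self _ _),
      fun p hp => Finset.le_sup (f := Prod.snd) hp⟩
  have hy : d + veblen a n' < cbRank x (veblen a n) := by
    rw [fix n x hx]
    obtain ⟨e, he⟩ := veblen_mem_range_opow a n
    have hn' := veblen_right_strictMono a hn'
    rw [← he] at hd hn' ⊢
    exact isPrincipal_add_omega0_opow e hd hn'
  obtain ⟨b, hb, -, hbx⟩ := exists_cbRank_eq hy (F := ∅) (by simp) (by simp [Above])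
  refine ⟨b, hb, fun p hp => ?_, ?_⟩
  · calc p.2 ≤ d := hFd p hp
      _ < d + veblen a n' := by simp
      _ = cbRank x b := hbx.symm
      _ ≤ cbRank p.1 b := cbRank_antitone b (hFx p hp)
  · rw [← add_omega0_opow hx, cbRank_add, hbx, cbRank_add_left _ _ veblen_pos]
    · exact ihn n' hn'
    · exact Order.one_le_iff_pos.2 (opow_pos a omega0_pos)

/-- At the point `veblen l (b + 1)` all ranks of level at most `l` exceed `b`, as `l ≤ ω ^ l`. -/
theorem lt_cbRank_veblen {m l b : Ordinal.{u}} (hm : m ≤ l) :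
    b < cbRank m (veblen l (Order.succ b)) :=
  calc b < Order.succ b := Order.lt_succ b
    _ ≤ cbRank (ω ^ l) (veblen l (Order.succ b)) := le_cbRank_veblen l _
    _ ≤ _ := cbRank_antitone _ (hm.trans (right_le_opow l one_lt_omega0))

end Worm

/-! ### Derivations in `RC` -/

namespace RCFormula

/-- The formula obtained by renaming each modality `⟨l⟩` to `⟨f l⟩`. -/
def rename (f : Ordinal.{u} → Ordinal.{u}) : RCFormula.{u} → RCFormula.{u}
  | top => top
  | conj φ ψ => conj (rename f φ) (rename f ψ)
  | dia l φ => dia (f l) (rename f φ)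

/-- `substTop φ χ` is the formula obtained from `φ` by substituting `χ` for `⊤`. -/
def substTop : RCFormula.{u} → RCFormula.{u} → RCFormula.{u}
  | top, χ => χ
  | conj φ ψ, χ => conj (substTop φ χ) (substTop ψ χ)
  | dia l φ, χ => dia l (substTop φ χ)

/-- All modalities `⟨l⟩` of the formula have `l < x`. -/
def ModalitiesLT (x : Ordinal.{u}) : RCFormula.{u} → Prop
  | top => True
  | conj φ ψ => ModalitiesLT x φ ∧ ModalitiesLT x ψ
  | dia l φ => l < x ∧ ModalitiesLT x φ

theorem rename_worm (f : Ordinal.{u} → Ordinal.{u}) (w : List Ordinal.{u}) :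
    rename f (worm w) = worm (w.map f) := by
  induction w with
  | nil => rfl
  | cons l w ih => simp [worm, rename, ih]

theorem substTop_worm (u w : List Ordinal.{u}) : substTop (worm w) (worm u) = worm (w ++ u) := by
  induction w with
  | nil => rfl
  | cons l w ih => simp [worm, substTop, ih]

theorem modalitiesLT_worm {x : Ordinal.{u}} {w : List Ordinal.{u}} :
    ModalitiesLT x (worm w) ↔ ∀ l ∈ w, l < x := by
  induction w with
  | nil => simp [worm, ModalitiesLT]
  | cons l w ih => simp [worm, ModalitiesLT, ih]

namespace Derives

theorem rename {f : Ordinal.{u} → Ordinal.{u}} (hf : StrictMono f) {φ ψ : RCFormula.{u}}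
    (h : Derives φ ψ) : Derives (φ.rename f) (ψ.rename f) := by
  induction h with
  | refl => exact .refl _
  | top => exact .top _
  | trans _ _ ih₁ ih₂ => exact .trans ih₁ ih₂
  | conj_left => exact .conj_left _ _
  | conj_right => exact .conj_right _ _
  | conj_intro _ _ ih₁ ih₂ => exact .conj_intro ih₁ ih₂
  | four => exact .four _ _
  | nec _ _ ih => exact .nec _ ih
  | mono _ h => exact .mono _ (hf.monotone h)
  | six _ _ h => exact .six _ _ (hf h)

theorem dia_zero_of_dia {l : Ordinal.{u}} {φ ψ : RCFormula.{u}} (h : Derives φ (dia 0 ψ)) :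
    Derives (dia l φ) (dia 0 ψ) :=
  ((mono φ zero_le).trans (nec 0 h)).trans (four 0 ψ)

theorem substTop_of_dia_zero (ψ φ : RCFormula.{u}) :
    Derives (φ.substTop (dia 0 ψ)) (dia 0 ψ) := by
  induction φ with
  | top => exact .refl _
  | conj φ θ ih _ => exact (conj_left _ _).trans ih
  | dia l φ ih => exact dia_zero_of_dia ih

/-- Derivability is preserved when `⊤` is replaced by a formula `⟨0⟩χ`. The axiom `φ ⇒ ⊤` survives
because each formula in which the replacement has been made derives `⟨0⟩χ`. -/
theorem substTop (χ : RCFormula.{u}) {φ ψ : RCFormula.{u}} (h : Derives φ ψ) :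
    Derives (φ.substTop (dia 0 χ)) (ψ.substTop (dia 0 χ)) := by
  induction h with
  | refl => exact .refl _
  | top => exact substTop_of_dia_zero χ _
  | trans _ _ ih₁ ih₂ => exact .trans ih₁ ih₂
  | conj_left => exact .conj_left _ _
  | conj_right => exact .conj_right _ _
  | conj_intro _ _ ih₁ ih₂ => exact .conj_intro ih₁ ih₂
  | four => exact .four _ _
  | nec _ _ ih => exact .nec _ ih
  | mono _ h => exact .mono _ h
  | six _ _ h => exact .six _ _ h

theorem modalitiesLT {x : Ordinal.{u}} {φ ψ : RCFormula.{u}} (h : Derives φ ψ)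
    (hφ : φ.ModalitiesLT x) : ψ.ModalitiesLT x := by
  induction h with
  | refl => exact hφ
  | top => trivial
  | trans _ _ ih₁ ih₂ => exact ih₂ (ih₁ hφ)
  | conj_left => exact hφ.1
  | conj_right => exact hφ.2
  | conj_intro _ _ ih₁ ih₂ => exact ⟨ih₁ hφ, ih₂ hφ⟩
  | four => exact hφ.2
  | nec _ _ ih => exact ⟨hφ.1, ih hφ.2⟩
  | mono _ h => exact ⟨h.trans_lt hφ.1, hφ.2⟩
  | six => exact ⟨hφ.1.1, hφ.1.2, hφ.2⟩

theorem dia_conj {l : Ordinal.{u}} (hl : 0 < l) {χ φ ψ : RCFormula.{u}}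
    (h₁ : Derives χ (dia l φ)) (h₂ : Derives χ (dia 0 ψ)) :
    Derives χ (dia l (conj φ (dia 0 ψ))) :=
  (h₁.conj_intro h₂).trans (six φ ψ hl)

theorem worm_append {w : List Ordinal.{u}} (hw : ∀ l ∈ w, 0 < l) (u : List Ordinal.{u}) :
    Derives (conj (worm w) (dia 0 (worm u))) (worm (w ++ 0 :: u)) := by
  induction w with
  | nil => exact .conj_right _ _
  | cons l w ih =>
    exact (six _ _ (hw l List.mem_cons_self)).trans
      (nec l (ih fun l hl => hw l (List.mem_cons_of_mem _ hl)))

end Derives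

end RCFormula

namespace Worm

open RCFormula

theorem Below.trans {t v w : List Ordinal.{u}} (h₁ : Below t v) (h₂ : Below v w) : Below t w :=
  (Derives.trans h₂ (.nec 0 h₁)).trans (.four 0 _)

theorem below_cons_zero (w : List Ordinal.{u}) : Below w (0 :: w) :=
  .refl _

theorem Below.append {v w : List Ordinal.{u}} (h : Below v w) (u : List Ordinal.{u}) :
    Below (v ++ 0 :: u) (w ++ 0 :: u) := by
  have h : Derives (substTop (worm w) (worm (0 :: u)))
      (dia 0 (substTop (worm v) (worm (0 :: u)))) := h.substTop (worm u)
  rwa [substTop_worm, substTop_worm] at h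

theorem below_append (u w : List Ordinal.{u}) : Below u (w ++ 0 :: u) := by
  have h : Derives (substTop (worm w) (worm (0 :: u))) (dia 0 (worm u)) :=
    .substTop_of_dia_zero (worm u) (worm w)
  rwa [substTop_worm] at h

theorem Below.derives_map_add {v w : List Ordinal.{u}} (h : Below v w) (x : Ordinal.{u}) :
    Derives (worm (w.map (x + ·))) (dia x (worm (v.map (x + ·)))) := by
  have := Derives.rename (f := (x + ·)) (fun _ _ h => by simpa using h) h
  simpa [rename_worm, RCFormula.rename] using this

theorem Below.map_add {v w : List Ordinal.{u}} (h : Below v w) (x : Ordinal.{u}) :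
    Below (v.map (x + ·)) (w.map (x + ·)) :=
  (h.derives_map_add x).trans (.mono _ zero_le)

theorem Below.forall_lt {v w : List Ordinal.{u}} (h : Below v w) {x : Ordinal.{u}}
    (hw : ∀ l ∈ w, l < x) : ∀ l ∈ v, l < x :=
  modalitiesLT_worm.1 (h.modalitiesLT (modalitiesLT_worm.2 hw)).2

end Worm

namespace Worm

open Ordinal

/-! ### The topological model of `RC` -/

/-- `Sat φ a`: the formula `φ` holds at the point `a` of the topological model on the ordinals, in
which `⟨l⟩φ` holds at the limit points, with respect to the `l`-th Icard topology, of the set of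
points where `φ` holds. -/
def Sat : RCFormula.{u} → Ordinal.{u} → Prop
  | .top, _ => True
  | .conj φ ψ, a => Sat φ a ∧ Sat ψ a
  | .dia l φ, a => ∀ F : Finset (Ordinal.{u} × Ordinal.{u}), (∀ p ∈ F, p.1 < l) → Above F a →
      ∃ b < a, Above F b ∧ Sat φ b

/-- Every finite set of conditions can be met. -/
theorem exists_above (F : Finset (Ordinal.{u} × Ordinal.{u})) : ∃ a, Above F a :=
  ⟨veblen (F.sup Prod.fst) (Order.succ (F.sup Prod.snd)), fun _ hp =>
    (Finset.le_sup (f := Prod.snd) hp).trans_lt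
      (lt_cbRank_veblen (Finset.le_sup (f := Prod.fst) hp))⟩

/-- If the truth set of `φ` is basic open, then so is that of `⟨l⟩φ`, by conditions at levels up to
`l` only. The conditions of `φ` at levels below `l` define a set that is closed and open in the
`l`-th topology and are retained. Those at levels from `l` on depend on `cbRank l` only; if `n` is
the least value for which they hold, they turn into the condition `n < cbRank l a`. -/
theorem exists_sat_dia_iff_above (l : Ordinal.{u}) {φ : RCFormula.{u}}
    {G : Finset (Ordinal.{u} × Ordinal.{u})} (hG : ∀ a, Sat φ a ↔ Above G a) :
    ∃ H : Finset (Ordinal.{u} × Ordinal.{u}), (∀ p ∈ H, p.1 ≤ l) ∧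
      ∀ a, Sat (.dia l φ) a ↔ Above H a := by
  classical
  let B : Set Ordinal.{u} := {n | ∃ b, Above G b ∧ cbRank l b = n}
  have hB : B.Nonempty := (exists_above G).elim fun b hb => ⟨_, b, hb, rfl⟩
  obtain ⟨c, hGc, hc⟩ := csInf_mem hB
  have hlow : ∀ p ∈ G.filter fun p => p.1 < l, p.1 < l := fun p hp => (Finset.mem_filter.1 hp).2
  refine ⟨(G.filter fun p => p.1 < l) ∪ {(l, sInf B)}, ?_, fun a => ⟨fun h => ?_, fun h => ?_⟩⟩
  · intro p hp
    rcases Finset.mem_union.1 hp with hp | hp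
    · exact (hlow p hp).le
    · rw [Finset.mem_singleton.1 hp]
  · rw [above_union]
    constructor
    · intro p hp
      by_contra! hle
      obtain ⟨F, hF, hFa, hlt⟩ := exists_nhd_cbRank_lt p.1 a
      obtain ⟨b, hb, hFb, hφ⟩ := h F (fun q hq => (hF q hq).trans (hlow p hp)) hFa
      exact ((hlt b hb hFb).trans_le hle).not_gt ((hG b).1 hφ p (Finset.mem_filter.1 hp).1)
    · obtain ⟨F, hF, hFa, hlt⟩ := exists_nhd_cbRank_lt l a
      obtain ⟨b, hb, hFb, hφ⟩ := h F hF hFa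
      intro p hp
      rw [Finset.mem_singleton.1 hp]
      exact (csInf_le' (show cbRank l b ∈ B from ⟨b, (hG b).1 hφ, rfl⟩)).trans_lt (hlt b hb hFb)
  · obtain ⟨h1, h2⟩ := above_union.1 h
    intro F hF hFa
    obtain ⟨b, hb, hab, e⟩ := exists_cbRank_eq (h2 _ (Finset.mem_singleton_self _))
      (F := F ∪ G.filter fun p => p.1 < l)
      (fun p hp => (Finset.mem_union.1 hp).elim (hF p) (hlow p)) (above_union.2 ⟨hFa, h1⟩)
    obtain ⟨hFb, hGb⟩ := above_union.1 hab
    refine ⟨b, hb, hFb, (hG b).2 fun p hp => ?_⟩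
    rcases lt_or_ge p.1 l with hl | hl
    · exact hGb p (Finset.mem_filter.2 ⟨hp, hl⟩)
    · have := hGc p hp
      rw [← Ordinal.add_sub_cancel_of_le hl, cbRank_add] at this ⊢
      rwa [show cbRank l b = cbRank l c from e.trans hc.symm]

theorem exists_sat_iff_above (φ : RCFormula.{u}) :
    ∃ G : Finset (Ordinal.{u} × Ordinal.{u}), ∀ a, Sat φ a ↔ Above G a := by
  classical
  induction φ with
  | top => exact ⟨∅, fun a => by simp [Sat, Above]⟩
  | conj φ ψ ihφ ihψ =>
    obtain ⟨G, hG⟩ := ihφ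
    obtain ⟨H, hH⟩ := ihψ
    exact ⟨G ∪ H, fun a => by rw [above_union, Sat, hG, hH]⟩
  | dia l φ ih =>
    obtain ⟨G, hG⟩ := ih
    obtain ⟨H, -, hH⟩ := exists_sat_dia_iff_above l hG
    exact ⟨H, hH⟩

theorem sat_of_derives {φ ψ : RCFormula.{u}} (h : RCFormula.Derives φ ψ) {a : Ordinal.{u}}
    (ha : Sat φ a) : Sat ψ a := by
  classical
  induction h generalizing a with
  | refl => exact ha
  | top => trivial
  | trans _ _ ih₁ ih₂ => exact ih₂ (ih₁ ha)
  | conj_left => exact ha.1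
  | conj_right => exact ha.2
  | conj_intro _ _ ih₁ ih₂ => exact ⟨ih₁ ha, ih₂ ha⟩
  | four l φ =>
    intro F hF hFa
    obtain ⟨b, hb, hFb, h⟩ := ha F hF hFa
    obtain ⟨c, hc, hFc, h⟩ := h F hF hFb
    exact ⟨c, hc.trans hb, hFc, h⟩
  | nec l _ ih =>
    intro F hF hFa
    obtain ⟨b, hb, hFb, h⟩ := ha F hF hFa
    exact ⟨b, hb, hFb, ih h⟩
  | mono φ hml =>
    intro F hF hFa
    exact ha F (fun p hp => (hF p hp).trans_le hml) hFa
  | @six l m φ ψ hml =>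
    -- The truth set of `⟨m⟩ψ` is open in the `l`-th topology.
    obtain ⟨G, hG⟩ := exists_sat_iff_above ψ
    obtain ⟨H, hHm, hH⟩ := exists_sat_dia_iff_above m hG
    intro F hF hFa
    obtain ⟨b, hb, hab, h⟩ := ha.1 (F ∪ H)
      (fun p hp => (Finset.mem_union.1 hp).elim (hF p) fun hp => (hHm p hp).trans_lt hml)
      (above_union.2 ⟨hFa, (hH a).1 ha.2⟩)
    obtain ⟨hFb, hHb⟩ := above_union.1 hab
    exact ⟨b, hb, hFb, h, (hH b).2 hHb⟩

theorem sat_dia_veblen {φ : RCFormula.{u}} {b : Ordinal.{u}} (hb : Sat φ b) (l : Ordinal.{u}) :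
    Sat (.dia l φ) (veblen l (Order.succ b)) := by
  classical
  obtain ⟨G, hG⟩ := exists_sat_iff_above φ
  intro F hF hFa
  -- A point of the same `l`-rank as `b` that meets the conditions of `φ` below level `l`.
  obtain ⟨c, hc, hac, e⟩ := exists_cbRank_eq
    ((cbRank_le_self l b).trans_lt (lt_cbRank_veblen le_rfl))
    (F := F ∪ G.filter fun p => p.1 < l)
    (fun p hp => (Finset.mem_union.1 hp).elim (hF p) fun hp => (Finset.mem_filter.1 hp).2)
    (above_union.2 ⟨hFa, fun p hp => by
      obtain ⟨hp, hl⟩ := Finset.mem_filter.1 hp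
      exact (((hG b).1 hb p hp).trans_le (cbRank_le_self _ b)).trans (lt_cbRank_veblen hl.le)⟩)
  obtain ⟨hFc, hGc⟩ := above_union.1 hac
  refine ⟨c, hc, hFc, (hG c).2 fun p hp => ?_⟩
  rcases lt_or_ge p.1 l with hl | hl
  · exact hGc p (Finset.mem_filter.2 ⟨hp, hl⟩)
  · have := (hG b).1 hb p hp
    rw [← Ordinal.add_sub_cancel_of_le hl, cbRank_add] at this ⊢
    rwa [e]

theorem exists_sat_worm (w : List Ordinal.{u}) : ∃ a, Sat (RCFormula.worm w) a := by
  induction w with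
  | nil => exact ⟨0, trivial⟩
  | cons l w ih =>
    obtain ⟨b, hb⟩ := ih
    exact ⟨_, sat_dia_veblen hb l⟩

theorem veblen_lt_gamma_zero {a b : Ordinal.{u}} (ha : a < Γ₀) (hb : b < Γ₀) :
    veblen a b < Γ₀ := by
  rw [← veblen_gamma_zero 0, veblen_lt_veblen_iff]
  exact .inr (.inl ⟨ha, by rwa [veblen_gamma_zero]⟩)

theorem exists_sat_worm_lt_gamma_zero {w : List Ordinal.{u}} (hw : ∀ l ∈ w, l < Γ₀) :
    ∃ a < Γ₀, Sat (RCFormula.worm w) a := by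
  induction w with
  | nil => exact ⟨0, gamma_pos, trivial⟩
  | cons l w ih =>
    obtain ⟨b, hbΓ, hb⟩ := ih fun l hl => hw l (List.mem_cons_of_mem _ hl)
    refine ⟨_, veblen_lt_gamma_zero (hw l List.mem_cons_self) ?_, sat_dia_veblen hb l⟩
    exact (Order.succ_le_of_lt (lt_veblen b)).trans_lt (veblen_lt_gamma_zero hbΓ hbΓ)

/-- The least point of the model at which `w` holds. -/
noncomputable def leastPoint (w : List Ordinal.{u}) : Ordinal.{u} :=
  sInf {a | Sat (RCFormula.worm w) a}

theorem leastPoint_lt_of_below {v w : List Ordinal.{u}} (h : Below v w) :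
    leastPoint v < leastPoint w := by
  obtain ⟨b, hb, -, hv⟩ :=
    sat_of_derives h (csInf_mem (exists_sat_worm w)) ∅ (by simp) (by simp [Above])
  exact (csInf_le' hv).trans_lt hb

theorem wellFounded_below : WellFounded (Below.{u}) :=
  Subrelation.wf (fun h => leastPoint_lt_of_below h) (InvImage.wf leastPoint wellFounded_lt)

theorem o_le_lift_leastPoint (w : List Ordinal.{u}) :
    o w ≤ Ordinal.lift.{u + 1} (leastPoint w) := by
  induction w using wellFounded_below.induction with
  | _ w ih =>
  rw [o, dif_pos (wellFounded_below.apply w), Acc.rank_eq]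
  refine Ordinal.iSup_le fun v => Order.succ_le_of_lt ?_
  have := ih v v.2
  rw [o, dif_pos (wellFounded_below.apply v.1)] at this
  exact this.trans_lt (Ordinal.lift_lt.2 (leastPoint_lt_of_below v.2))

/-- The order-type of a worm, as an ordinal of the universe of its entries. -/
noncomputable def orderType (w : List Ordinal.{u}) : Ordinal.{u} :=
  (Ordinal.mem_range_lift_of_le (o_le_lift_leastPoint w)).choose

theorem lift_orderType (w : List Ordinal.{u}) : Ordinal.lift.{u + 1} (orderType w) = o w :=
  (Ordinal.mem_range_lift_of_le (o_le_lift_leastPoint w)).choose_spec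

theorem orderType_lt_gamma_zero {w : List Ordinal.{u}} (hw : ∀ l ∈ w, l < Γ₀) :
    orderType w < Γ₀ := by
  obtain ⟨a, ha, h⟩ := exists_sat_worm_lt_gamma_zero hw
  have : orderType w ≤ leastPoint w := by
    rw [← Ordinal.lift_le.{u + 1}, lift_orderType]
    exact o_le_lift_leastPoint w
  exact (this.trans (csInf_le' h)).trans_lt ha

theorem orderType_lt_of_below {v w : List Ordinal.{u}} (h : Below v w) :
    orderType v < orderType w := by
  rw [← Ordinal.lift_lt.{u + 1}, lift_orderType, lift_orderType, o, o,
    dif_pos (wellFounded_below.apply w), dif_pos (wellFounded_below.apply v)]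
  exact Acc.rank_lt_of_rel _ h

theorem exists_below_of_lt_orderType {w : List Ordinal.{u}} {x : Ordinal.{u}}
    (hx : x < orderType w) : ∃ v, Below v w ∧ orderType v = x := by
  induction w using wellFounded_below.induction with
  | _ w ih =>
  have h := hx
  rw [← Ordinal.lift_lt.{u + 1}, lift_orderType, o, dif_pos (wellFounded_below.apply w),
    Acc.rank_eq, Ordinal.lt_iSup_iff] at h
  obtain ⟨⟨v, hv⟩, h⟩ := h
  have hxv : x ≤ orderType v := by
    rw [← Ordinal.lift_le.{u + 1}, lift_orderType, o, dif_pos (wellFounded_below.apply v)]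
    exact Order.lt_succ_iff.1 h
  rcases hxv.eq_or_lt with e | hlt
  · exact ⟨v, hv, e.symm⟩
  · obtain ⟨t, ht, e⟩ := ih v hv hlt
    exact ⟨t, ht.trans hv, e⟩

end Worm

/-! ### Lower bounds for order-types -/

namespace Worm

open Ordinal RCFormula

theorem one_add_le_succ (x : Ordinal.{u}) : 1 + x ≤ Order.succ x := by
  rcases lt_or_ge x ω with h | h
  · obtain ⟨n, rfl⟩ := lt_omega0.1 h
    rw [Order.succ_eq_add_one]
    exact_mod_cast (Nat.add_comm 1 n).le
  · rw [one_add_of_omega0_le h]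
    exact Order.le_succ x

theorem orderType_add_orderType_le (u w : List Ordinal.{u}) :
    orderType u + orderType w ≤ orderType (w ++ 0 :: u) := by
  induction w using wellFounded_below.induction with
  | _ w ih =>
  refine le_of_forall_lt fun x hx => ?_
  have hu := orderType_lt_of_below (below_append u w)
  rcases lt_or_ge x (orderType u) with h | h
  · exact h.trans hu
  · obtain ⟨y, rfl⟩ := exists_add_of_le h
    obtain ⟨v, hv, rfl⟩ := exists_below_of_lt_orderType (by simpa using hx)
    exact (ih v hv).trans_lt (orderType_lt_of_below (hv.append u))

/-- The worm `1 + w` derives `⟨1⟩(1 + v)` for each `v` below `w`, hence has all finite iterations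
`(1 + v) 0 (1 + v) 0 ⋯` below it. -/
theorem opow_le_orderType_map_one_add {x : Ordinal.{u}} {w : List Ordinal.{u}}
    (hx : 1 + x ≤ orderType w) : ω ^ x ≤ orderType (w.map (1 + ·)) := by
  induction x using WellFoundedLT.induction generalizing w with
  | ind x ih =>
  refine le_of_forall_lt fun y hy => ?_
  rcases eq_or_ne x 0 with rfl | hx0
  · obtain ⟨v, hv, -⟩ := exists_below_of_lt_orderType
      (zero_lt_one.trans_le ((add_zero (1 : Ordinal.{u})).ge.trans hx))
    rw [opow_zero, Order.lt_one_iff] at hy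
    exact hy ▸ zero_le.trans_lt (orderType_lt_of_below (hv.map_add 1))
  · obtain ⟨c, hc, n, hn⟩ := (lt_omega0_opow hx0).1 hy
    obtain ⟨v, hv, e⟩ := exists_below_of_lt_orderType ((add_lt_add_right hc 1).trans_le hx)
    have hcv := ih c hc e.ge
    have key : ∀ k : ℕ, ∃ u, Below u (w.map (1 + ·)) ∧ ω ^ c * k ≤ orderType u := by
      intro k
      induction k with
      | zero => exact ⟨_, hv.map_add 1, by simp⟩
      | succ k ihk =>
        obtain ⟨u, hu, hk⟩ := ihk
        refine ⟨v.map (1 + ·) ++ 0 :: u, ?_, ?_⟩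
        · refine ((Derives.dia_conj zero_lt_one (hv.derives_map_add 1) hu).trans
            (.mono _ zero_le)).trans (.nec 0 (Derives.worm_append ?_ u))
          intro l hl
          obtain ⟨m, -, rfl⟩ := List.mem_map.1 hl
          exact zero_lt_one.trans_le le_self_add
        · rw [Nat.cast_succ, mul_add_one]
          exact (add_le_add hk hcv).trans (orderType_add_orderType_le _ _)
    obtain ⟨u, hu, hk⟩ := key n
    exact hn.trans_le (hk.trans (orderType_lt_of_below hu).le)

/-- Let `b > 0` and let `w` be a worm other than `⊤`. Shifting by `ω ^ c` with `c < b` does not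
change the worm `ω ^ b + w`, so that the worms below it are closed under these shifts. By induction
on `b` its order-type is then a common fixed point of the functions `veblen c`. -/
theorem veblen_le_orderType_map_add (b : Ordinal.{u}) {x : Ordinal.{u}} {w : List Ordinal.{u}}
    (hx : 1 + x ≤ orderType w) : veblen b x ≤ orderType (w.map (ω ^ b + ·)) := by
  induction b using WellFoundedLT.induction generalizing x w with
  | ind b ihb =>
  rcases eq_or_ne b 0 with rfl | hb
  · simpa using opow_le_orderType_map_one_add hx
  induction x using WellFoundedLT.induction generalizing w with
  | ind x ihx =>
  obtain ⟨v₀, hv₀, -⟩ := exists_below_of_lt_orderType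
    (zero_lt_one.trans_le (le_self_add.trans hx))
  have hpos : 0 < ω ^ b := opow_pos b omega0_pos
  have hsucc : ∀ y < orderType (w.map (ω ^ b + ·)),
      Order.succ y < orderType (w.map (ω ^ b + ·)) := by
    intro y hy
    obtain ⟨u, hu, rfl⟩ := exists_below_of_lt_orderType hy
    have h : Below (0 :: u) (w.map (ω ^ b + ·)) :=
      ((Derives.dia_conj hpos (hv₀.derives_map_add _) hu).trans (.mono _ zero_le)).trans
        (.nec 0 (.conj_right _ _))
    exact (Order.succ_le_of_lt (orderType_lt_of_below (below_cons_zero u))).trans_lt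
      (orderType_lt_of_below h)
  have hlim : Order.IsSuccLimit (orderType (w.map (ω ^ b + ·))) := by
    refine ⟨?_, Order.isSuccPrelimit_of_succ_lt hsucc⟩
    rw [isMin_iff_eq_bot]
    exact (bot_le.trans_lt (orderType_lt_of_below (hv₀.map_add (ω ^ b)))).ne'
  have hclosed : ∀ c < b, ∀ y < orderType (w.map (ω ^ b + ·)),
      veblen c y < orderType (w.map (ω ^ b + ·)) := by
    intro c hc y hy
    have hy' : 1 + y < orderType (w.map (ω ^ b + ·)) :=
      (one_add_le_succ y).trans_lt (hsucc y hy)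
    obtain ⟨u, hu, e⟩ := exists_below_of_lt_orderType hy'
    have h := hu.map_add (ω ^ c)
    have hcomp : (ω ^ c + ·) ∘ (ω ^ b + ·) = (ω ^ b + · : Ordinal.{u} → Ordinal.{u}) := by
      funext l
      simp only [Function.comp, ← add_assoc,
        add_omega0_opow ((opow_lt_opow_iff_right one_lt_omega0).2 hc)]
    rw [List.map_map, hcomp] at h
    exact (ihb c hc e.ge).trans_lt (orderType_lt_of_below h)
  obtain ⟨z, hz⟩ := (mem_range_veblen hb).2 fun c hc =>
    (((isNormal_veblen c).le_iff_forall_le hlim).2 fun y hy => (hclosed c hc y hy).le).antisymm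
      (right_le_veblen c _)
  rw [← hz, veblen_le_veblen_iff_right]
  refine le_of_forall_lt fun y hy => ?_
  obtain ⟨v, hv, e⟩ := exists_below_of_lt_orderType ((add_lt_add_right hy 1).trans_le hx)
  rw [← veblen_lt_veblen_iff_right (o := b), hz]
  exact (ihx y hy e.ge).trans_lt (orderType_lt_of_below (hv.map_add _))

/-- The worms with entries below `ω ^ a` have order-types cofinal in `veblen a 0`, because this
ordinal is the limit of the values obtained from `0` by the functions `veblen b` with `b < a`. -/
theorem exists_le_orderType_of_lt_veblen {a x : Ordinal.{u}} (ha : a ≠ 0) (hx : x < veblen a 0) :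
    ∃ w : List Ordinal.{u}, (∀ l ∈ w, l < ω ^ a) ∧ x ≤ orderType w := by
  rw [veblen_of_ne_zero ha, derivFamily_zero, lt_nfpFamily_iff] at hx
  obtain ⟨L, hL⟩ := hx
  suffices h : ∃ w : List Ordinal.{u}, (∀ l ∈ w, l < ω ^ a) ∧
      L.foldr (fun b : Set.Iio a => veblen b) 0 ≤ orderType w by
    obtain ⟨w, hw, h⟩ := h
    exact ⟨w, hw, hL.le.trans h⟩
  clear hL
  induction L with
  | nil => exact ⟨[], by simp, by simp⟩
  | cons b L ih =>
    obtain ⟨w, hw, h⟩ := ih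
    refine ⟨(0 :: w).map (ω ^ b.1 + ·), ?_, veblen_le_orderType_map_add b.1 ?_⟩
    · have hb : ω ^ b.1 < ω ^ a := (opow_lt_opow_iff_right one_lt_omega0).2 b.2
      intro l hl
      obtain ⟨m, hm, rfl⟩ := List.mem_map.1 hl
      refine isPrincipal_add_omega0_opow a hb ?_
      rcases List.mem_cons.1 hm with rfl | hm
      · exact opow_pos a omega0_pos
      · exact hw m hm
    · exact (one_add_le_succ _).trans ((Order.succ_le_succ h).trans
        (Order.succ_le_of_lt (orderType_lt_of_below (below_cons_zero w))))

theorem natCast_le_orderType_replicate (n : ℕ) :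
    (n : Ordinal.{u}) ≤ orderType (List.replicate n 0) := by
  induction n with
  | zero => simp
  | succ n ih =>
    rw [Nat.cast_succ]
    exact Order.add_one_le_of_lt (ih.trans_lt (orderType_lt_of_below (below_cons_zero _)))

/-- If `x` is infinite, the entries may be taken below `ω ^ log ω x ≤ x`. -/
theorem exists_orderType_eq {x : Ordinal.{u}} (hx : x < Γ₀) :
    ∃ w : List Ordinal.{u}, (∀ l ∈ w, l < x) ∧ orderType w = x := by
  obtain ⟨w, hw, h⟩ : ∃ w : List Ordinal.{u}, (∀ l ∈ w, l < x) ∧ x ≤ orderType w := by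
    rcases lt_or_ge x ω with hω | hω
    · obtain ⟨n, rfl⟩ := lt_omega0.1 hω
      refine ⟨_, fun l hl => ?_, natCast_le_orderType_replicate n⟩
      rw [List.eq_of_mem_replicate hl]
      have := List.length_pos_of_mem hl
      rw [List.length_replicate] at this
      exact_mod_cast this
    · have hx0 : x ≠ 0 := (omega0_pos.trans_le hω).ne'
      have ha : Ordinal.log ω x ≠ 0 := (log_pos one_lt_omega0 hx0 hω).ne'
      obtain ⟨w, hw, h⟩ := exists_le_orderType_of_lt_veblen ha (x := x) (by
        have h1 : Ordinal.log ω x < veblen (Ordinal.log ω x) 0 := by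
          by_contra! h
          exact (gamma_zero_le_of_veblen_le h).not_gt ((log_le_self _ _).trans_lt hx)
        have h2 : ω ^ veblen (Ordinal.log ω x) 0 = veblen (Ordinal.log ω x) 0 := by
          rw [← veblen_zero_apply, veblen_veblen_of_lt (pos_iff_ne_zero.2 ha)]
        rw [← h2]
        exact (lt_opow_succ_log_self one_lt_omega0 x).trans_le
          (opow_le_opow_right omega0_pos (Order.succ_le_of_lt h1)))
      exact ⟨w, fun l hl => (hw l hl).trans_le (opow_log_le_self ω hx0), h⟩
  rcases h.eq_or_lt with e | hlt
  · exact ⟨w, hw, e.symm⟩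
  · obtain ⟨v, hv, e⟩ := exists_below_of_lt_orderType hlt
    exact ⟨v, hv.forall_lt hw, e⟩

end Worm

theorem mainTheorem6 :
    IsLeast {Θ : Set Ordinal.{u} | Worm.IsWormPerfect Θ} (Set.Iio Γ₀) := by
  constructor
  · refine Set.Subset.antisymm ?_ ?_
    · rintro _ ⟨x, hx, rfl⟩
      obtain ⟨w, hw, rfl⟩ := Worm.exists_orderType_eq hx
      exact ⟨w, fun l hl => (hw l hl).trans hx, (Worm.lift_orderType w).symm⟩
    · rintro _ ⟨w, hw, rfl⟩
      exact ⟨_, Worm.orderType_lt_gamma_zero hw, Worm.lift_orderType w⟩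
  · intro Θ hΘ x hx
    have hΘ : Ordinal.lift.{u + 1, u} '' Θ = Worm.o '' {w | ∀ l ∈ w, l ∈ Θ} := hΘ
    induction x using WellFoundedLT.induction with
    | ind x ih =>
    obtain ⟨w, hw, rfl⟩ := Worm.exists_orderType_eq hx
    have h : Worm.o w ∈ Ordinal.lift.{u + 1, u} '' Θ :=
      hΘ ▸ ⟨w, fun l hl => ih l (hw l hl) ((hw l hl).trans hx), rfl⟩
    obtain ⟨y, hy, e⟩ := h
    rw [← Worm.lift_orderType, Ordinal.lift_inj] at e
    exact e ▸ hy
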